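/- Let $n\ge 0$ be an integer and let $\sigma$ be a full cycle on $\{0,1,\dots,n\}$, that is, a permutation $\sigma=(s_0\,s_1\,\cdots\,s_n)$ with $s_0=0$ having all of $0,\dots,n$ on one cycle (for $n=0$, the identity). A *minimal factorization* of $\sigma$ is a sequence $(\tau_1,\dots,\tau_n)$ of $n$ transpositions of $\{0,\dots,n\}$ with $\tau_1\tau_2\cdots\tau_n=\sigma$, where permutations are multiplied from left to right (so $\tau_1$ acts first); let $\mathcal F_\sigma$ be the set of these. Writing $\tau_i=(a_i\,b_i)$ with $a_i<b_i$, put $L_\sigma(\tau_1,\dots,\tau_n)=(a_1,\dots,a_n)$ (the lower sequence) and $U_\sigma(\tau_1,\dots,\tau_n)=(b_1,\dots,b_n)$ (the upper sequence). Let $\mathcal P_n$ be the set of parking functions of length $n$, i.e. the sequences $(a_1,\dots,a_n)$ of nonnegative integers whose non-decreasing rearrangement $(a_1',\dots,a_n')$ satisfies $a_i'\le i-1$ for all $1\le i\le n$, and let $\mathcal M_n=\{(n-a_1,\dots,n-a_n):(a_1,\dots,a_n)\in\mathcal P_n\}$ be the set of major sequences of length $n$. Call $\sigma$ *unimodal*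 if there is an index $N\in\{0,\dots,n\}$ with $s_N=n$ and $s_0<s_1<\cdots<s_N>s_{N+1}>\cdots>s_n$. Then $L_\sigma(\mathcal F_\sigma)\subseteq\mathcal P_n$ and $U_\sigma(\mathcal F_\sigma)\subseteq\mathcal M_n$. Moreover, the following are equivalent: 1. $\sigma$ is unimodal; 2. $L_\sigma:\mathcal F_\sigma\to\mathcal P_n$ is a bijection; 3. $U_\sigma:\mathcal F_\sigma\to\mathcal M_n$ is a bijection. -/

import Mathlib

namespace FullCycleFact

/-- The transpositions of the symbols `0, 1, …, n`. -/
abbrev Transposition (n : ℕ) : Type :=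
  {τ : Equiv.Perm (Fin (n + 1)) // τ.IsSwap}

theorem Transposition.support_nonempty {n : ℕ} (τ : Transposition n) :
    τ.1.support.Nonempty := by
  obtain ⟨x, y, hxy, h⟩ := τ.2
  exact ⟨x, by rw [h, Equiv.Perm.support_swap hxy]; simp⟩

/-- The smaller of the two symbols exchanged by a transposition. -/
def lower {n : ℕ} (τ : Transposition n) : Fin (n + 1) :=
  τ.1.support.min' τ.support_nonempty

/-- The larger of the two symbols exchanged by a transposition. -/
def upper {n : ℕ} (τ : Transposition n) : Fin (n + 1) :=
  τ.1.support.max' τ.support_nonempty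

/-- A permutation of `{0, …, n}` is a full cycle if all symbols lie on a single cycle of it
(for `n = 0` this is the identity). -/
def IsFullCycle {n : ℕ} (σ : Equiv.Perm (Fin (n + 1))) : Prop :=
  σ.IsCycleOn Set.univ

/-- Minimal factorizations `τ₁ τ₂ ⋯ τₙ = σ`. Permutations are multiplied from left to right, that
is, `τ₁` acts first; as Mathlib multiplies from right to left, the list of factors is reversed. -/
def minimalFactorizations {n : ℕ} (σ : Equiv.Perm (Fin (n + 1))) :
    Set (Fin n → Transposition n) :=
  {f | (List.ofFn fun i => (f i).1).reverse.prod = σ}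

/-- The lower sequence `(a₁, …, aₙ)` of `(a₁ b₁) ⋯ (aₙ bₙ)`, where `aᵢ < bᵢ`. -/
def lowerSeq {n : ℕ} (f : Fin n → Transposition n) : Fin n → ℕ :=
  fun i => (lower (f i) : ℕ)

/-- The upper sequence `(b₁, …, bₙ)` of `(a₁ b₁) ⋯ (aₙ bₙ)`, where `aᵢ < bᵢ`. -/
def upperSeq {n : ℕ} (f : Fin n → Transposition n) : Fin n → ℕ :=
  fun i => (upper (f i) : ℕ)

/-- Parking functions of length `n`: the non-decreasing rearrangement `a'` satisfies
`a'ᵢ ≤ i - 1` for `1 ≤ i ≤ n`; here positions are counted from `0`. -/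
def parkingFunctions (n : ℕ) : Set (Fin n → ℕ) :=
  {a | ∀ i : Fin n, (a ∘ Tuple.sort a) i ≤ (i : ℕ)}

/-- Major sequences of length `n`: the complements `(n - a₁, …, n - aₙ)` of parking functions. -/
def majorSequences (n : ℕ) : Set (Fin n → ℕ) :=
  {b | ∃ a ∈ parkingFunctions n, ∀ i, a i + b i = n}

/-- Writing a full cycle as `(s₀ s₁ ⋯ sₙ)` with `s₀ = 0`, so that `sₖ = σᵏ(0)`, it is unimodal if
`s₀ < s₁ < ⋯ < s_N > ⋯ > sₙ` for some `N` with `s_N = n`. -/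
def IsUnimodal {n : ℕ} (σ : Equiv.Perm (Fin (n + 1))) : Prop :=
  ∃ N ≤ n, (σ ^ N) 0 = Fin.last n ∧
    StrictMonoOn (fun k : ℕ => (σ ^ k) 0) (Set.Icc 0 N) ∧
    StrictAntiOn (fun k : ℕ => (σ ^ k) 0) (Set.Icc N n)

end FullCycleFact

namespace FullCycleFact

section Weights

variable {V : Type*} [LinearOrder V]

/-- Total weight of the entries of `l` that are at least `k`. -/
def sumFrom (w : V → ℤ) (k : V) (l : List V) : ℤ :=
  (l.map fun y => if k ≤ y then w y else 0).sum

/-- All sums of weights over the nonempty upper sections of `l` are positive. -/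
def Parks (w : V → ℤ) (l : List V) : Prop :=
  ∀ x ∈ l, 1 ≤ sumFrom w x l

/-- The weights of `l` have positive upper sections and total `1`. -/
def Balanced (w : V → ℤ) (l : List V) : Prop :=
  (l.map w).sum = 1 ∧ Parks w l

/-- No entry has larger entries on both of its sides. -/
def Valleyless (l : List V) : Prop :=
  ∀ c a d, [c, a, d].Sublist l → a < c → ¬ a < d

@[simp] theorem sumFrom_nil (w : V → ℤ) (k : V) : sumFrom w k [] = 0 := rfl

@[simp] theorem sumFrom_cons (w : V → ℤ) (k x : V) (l : List V) :
    sumFrom w k (x :: l) = (if k ≤ x then w x else 0) + sumFrom w k l := by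
  simp [sumFrom]

@[simp] theorem sumFrom_append (w : V → ℤ) (k : V) (l l' : List V) :
    sumFrom w k (l ++ l') = sumFrom w k l + sumFrom w k l' := by
  simp [sumFrom]

theorem sumFrom_perm {w : V → ℤ} {l l' : List V} (h : l.Perm l') (k : V) :
    sumFrom w k l = sumFrom w k l' :=
  (h.map _).sum_eq

theorem sumFrom_congr {w w' : V → ℤ} {l : List V} (h : ∀ x ∈ l, w x = w' x) (k : V) :
    sumFrom w k l = sumFrom w' k l := by
  unfold sumFrom
  congr 1
  exact List.map_congr_left fun x hx => by rw [h x hx]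

theorem sumFrom_eq_sum {w : V → ℤ} {k : V} {l : List V} (h : ∀ x ∈ l, k ≤ x) :
    sumFrom w k l = (l.map w).sum := by
  unfold sumFrom
  congr 1
  exact List.map_congr_left fun x hx => by rw [if_pos (h x hx)]

theorem sumFrom_eq_zero {w : V → ℤ} {k : V} {l : List V} (h : ∀ x ∈ l, x < k) :
    sumFrom w k l = 0 := by
  induction l with
  | nil => rfl
  | cons x l ih =>
    rw [sumFrom_cons, if_neg (not_le.2 (h x (by simp))), ih fun y hy => h y (by simp [hy]), add_zero]

theorem Parks.perm {w : V → ℤ} {l l' : List V} (h : Parks w l) (hl : l.Perm l') : Parks w l' :=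
  fun x hx => by rw [← sumFrom_perm hl]; exact h x (hl.mem_iff.2 hx)

theorem Balanced.perm {w : V → ℤ} {l l' : List V} (h : Balanced w l) (hl : l.Perm l') :
    Balanced w l' :=
  ⟨by rw [← (hl.map w).sum_eq]; exact h.1, h.2.perm hl⟩

theorem Parks.congr {w w' : V → ℤ} {l : List V} (h : Parks w l) (hw : ∀ x ∈ l, w x = w' x) :
    Parks w' l :=
  fun x hx => by rw [← sumFrom_congr hw]; exact h x hx

theorem Balanced.congr {w w' : V → ℤ} {l : List V} (h : Balanced w l)
    (hw : ∀ x ∈ l, w x = w' x) : Balanced w' l :=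
  ⟨by rw [← List.map_congr_left hw]; exact h.1, h.2.congr hw⟩

theorem parks_nil (w : V → ℤ) : Parks w [] := fun x hx => by simp at hx

theorem exists_min_mem {l : List V} (h : l ≠ []) : ∃ m ∈ l, ∀ x ∈ l, m ≤ x := by
  obtain ⟨m, hm, hmin⟩ := l.toFinset.exists_min_image id (by simpa using h)
  exact ⟨m, by simpa using hm, fun x hx => hmin x (by simpa using hx)⟩

theorem Parks.one_le_sumFrom {w : V → ℤ} {l : List V} (h : Parks w l) {k y : V} (hy : y ∈ l)
    (hky : k ≤ y) : 1 ≤ sumFrom w k l := by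
  obtain ⟨m, hm, hmin⟩ := exists_min_mem (l := l.filter fun x => k ≤ x)
    (List.ne_nil_of_mem (List.mem_filter.2 ⟨hy, by simpa using hky⟩))
  simp only [List.mem_filter, decide_eq_true_eq] at hm hmin
  have : sumFrom w k l = sumFrom w m l := by
    unfold sumFrom
    congr 1
    refine List.map_congr_left fun x hx => ?_
    by_cases hkx : k ≤ x
    · rw [if_pos hkx, if_pos (hmin x ⟨hx, hkx⟩)]
    · rw [if_neg hkx, if_neg fun h => hkx (hm.2.trans h)]
  rw [this]
  exact h m hm.1

theorem Parks.sumFrom_nonneg {w : V → ℤ} {l : List V} (h : Parks w l) (k : V) :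
    0 ≤ sumFrom w k l := by
  by_cases hk : ∃ y ∈ l, k ≤ y
  · obtain ⟨y, hy, hky⟩ := hk
    exact zero_le_one.trans (h.one_le_sumFrom hy hky)
  · push Not at hk
    rw [sumFrom_eq_zero hk]

theorem Parks.one_le_sum {w : V → ℤ} {l : List V} (h : Parks w l) (hl : l ≠ []) :
    1 ≤ (l.map w).sum := by
  obtain ⟨m, hm, hmin⟩ := exists_min_mem hl
  rw [← sumFrom_eq_sum hmin]
  exact h m hm

theorem parks_cons_iff {w : V → ℤ} {m : V} {l : List V} (h : ∀ x ∈ l, m < x) :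
    Parks w (m :: l) ↔ 1 ≤ w m + (l.map w).sum ∧ Parks w l := by
  simp only [Parks, List.mem_cons, forall_eq_or_imp, sumFrom_cons, le_refl, if_true]
  rw [sumFrom_eq_sum fun x hx => (h x hx).le]
  refine and_congr_right fun _ => forall₂_congr fun x hx => ?_
  rw [if_neg (not_le.2 (h x hx)), zero_add]

theorem parks_concat_iff {w : V → ℤ} {m : V} {l : List V} (h : ∀ x ∈ l, m < x) :
    Parks w (l ++ [m]) ↔ 1 ≤ (l.map w).sum + w m ∧ Parks w l := by
  rw [add_comm, ← parks_cons_iff h]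
  exact ⟨fun h => h.perm (List.perm_append_singleton m l),
    fun h => h.perm (List.perm_append_singleton m l).symm⟩

theorem Valleyless.sublist {l l' : List V} (h : Valleyless l) (hl : l'.Sublist l) :
    Valleyless l' :=
  fun c a d hs => h c a d (hs.trans hl)

/-- A list without valleys has its minimum at one of its ends. -/
theorem Valleyless.exists_min {l : List V} (h : Valleyless l) (hn : l.Nodup) (hl : l ≠ []) :
    ∃ m L, (l = m :: L ∨ l = L ++ [m]) ∧ ∀ x ∈ L, m < x := by
  obtain ⟨m, hm, hmin⟩ := exists_min_mem hl
  obtain ⟨P, Q, rfl⟩ := List.append_of_mem hm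
  have hlt : ∀ x ∈ P ++ Q, m < x := by
    intro x hx
    refine lt_of_le_of_ne (hmin x ?_) ?_
    · simp only [List.mem_append, List.mem_cons] at hx ⊢; tauto
    · rintro rfl
      exact (List.nodup_middle.1 hn).notMem hx
  rcases P with _ | ⟨p, P⟩
  · exact ⟨m, Q, Or.inl rfl, by simpa using hlt⟩
  rcases Q with _ | ⟨q, Q⟩
  · exact ⟨m, p :: P, Or.inr rfl, by simpa using hlt⟩
  refine absurd (hlt q (by simp)) (h p m q ?_ (hlt p (by simp)))
  simp only [List.cons_append, List.cons_sublist_cons]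
  refine List.Sublist.trans ?_ (List.sublist_append_right _ _)
  simp

theorem exists_split {w : V → ℤ} (hw : ∀ x, w x ≤ 1) (l : List V) (hn : l.Nodup)
    (hv : Valleyless l) (hp : Parks w l) {t : ℤ} (h0 : 0 ≤ t) (ht : t ≤ (l.map w).sum) :
    ∃ P Q, P ++ Q = l ∧ Parks w P ∧ Parks w Q ∧ (P.map w).sum = t := by
  induction hlen : l.length generalizing l t with
  | zero =>
    rw [List.length_eq_zero_iff] at hlen
    subst hlen
    exact ⟨[], [], rfl, hp, hp, by simp at ht ⊢; omega⟩
  | succ k ih =>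
    obtain ⟨m, L, rfl | rfl, hm⟩ := hv.exists_min hn (by rintro rfl; simp at hlen)
    · obtain rfl | h1 := h0.eq_or_lt
      · exact ⟨[], m :: L, rfl, parks_nil w, hp, rfl⟩
      rw [parks_cons_iff hm] at hp
      have := hw m
      simp only [List.map_cons, List.sum_cons] at ht
      obtain ⟨P, Q, rfl, hP, hQ, hs⟩ := ih L hn.of_cons (hv.sublist (by simp)) hp.2
        (t := t - w m) (by omega) (by omega) (by simpa using hlen)
      refine ⟨m :: P, Q, rfl, (parks_cons_iff fun x hx => hm x (by simp [hx])).2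
        ⟨by omega, hP⟩, hQ, by simp [hs]⟩
    · obtain rfl | h1 := ht.eq_or_lt
      · exact ⟨L ++ [m], [], by simp, hp, parks_nil w, rfl⟩
      rw [parks_concat_iff hm] at hp
      have := hw m
      simp only [List.map_append, List.sum_append, List.map_cons, List.map_nil, List.sum_cons,
        List.sum_nil, add_zero] at h1
      obtain ⟨P, Q, rfl, hP, hQ, hs⟩ := ih L (hn.sublist (by simp)) (hv.sublist (by simp)) hp.2
        h0 (by omega) (by simpa using hlen)
      simp only [List.map_append, List.sum_append] at h1
      exact ⟨P, Q ++ [m], by simp, hP, (parks_concat_iff fun x hx => hm x (by simp [hx])).2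
        ⟨by omega, hQ⟩, hs⟩

theorem split_unique {w : V → ℤ} (l : List V) (hn : l.Nodup) (hv : Valleyless l)
    {P Q P' Q' : List V} (h : P ++ Q = l) (hP : Parks w P) (hQ : Parks w Q) (h' : P' ++ Q' = l)
    (hP' : Parks w P') (hQ' : Parks w Q') (ht : (P.map w).sum = (P'.map w).sum) : P = P' := by
  induction hlen : l.length generalizing l P Q P' Q' with
  | zero =>
    rw [List.length_eq_zero_iff] at hlen
    subst hlen
    simp only [List.append_eq_nil_iff] at h h'
    rw [h.1, h'.1]
  | succ k ih =>
    obtain ⟨m, L, hl | hl, hm⟩ := hv.exists_min hn (by rintro rfl; simp at hlen)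
    · rcases P with _ | ⟨p, P⟩
      · by_contra hne
        have := hP'.one_le_sum (Ne.symm hne)
        simp at ht; omega
      rcases P' with _ | ⟨p', P'⟩
      · have := hP.one_le_sum (by simp)
        rw [ht] at this
        simp at this
      rw [hl] at h h'
      simp only [List.cons_append, List.cons.injEq] at h h'
      obtain ⟨rfl, h⟩ := h
      obtain ⟨rfl, h'⟩ := h'
      subst hl
      rw [parks_cons_iff fun x hx => hm x (by simp [← h, hx])] at hP
      rw [parks_cons_iff fun x hx => hm x (by simp [← h', hx])] at hP'
      rw [ih L hn.of_cons (hv.sublist (by simp)) h hP.2 hQ h' hP'.2 hQ' (by simpa using ht)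
        (by simpa using hlen)]
    · have hs := congrArg (fun l => (l.map w).sum) (h.trans h'.symm)
      simp only [List.map_append, List.sum_append] at hs
      rcases List.eq_nil_or_concat' Q with rfl | ⟨Q, q, rfl⟩
      · rcases List.eq_nil_or_concat' Q' with rfl | ⟨Q', q', rfl⟩
        · simpa using h.trans h'.symm
        · have := hQ'.one_le_sum (by simp)
          rw [List.map_nil, List.sum_nil] at hs
          omega
      rcases List.eq_nil_or_concat' Q' with rfl | ⟨Q', q', rfl⟩
      · have := hQ.one_le_sum (by simp)
        rw [List.map_nil, List.sum_nil] at hs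
        omega
      rw [hl, ← List.append_assoc] at h h'
      obtain ⟨e, hq⟩ := List.append_inj' h rfl
      obtain ⟨e', hq'⟩ := List.append_inj' h' rfl
      simp only [List.cons.injEq, and_true] at hq hq'
      subst hq; subst hq'; subst hl
      rw [parks_concat_iff fun x hx => hm x (by simp [← e, hx])] at hQ
      rw [parks_concat_iff fun x hx => hm x (by simp [← e', hx])] at hQ'
      exact ih L (hn.sublist (by simp)) (hv.sublist (by simp)) e hP hQ.2 e' hP' hQ'.2 ht
        (by simpa using hlen)

/-- Cutting a balanced cyclic list `a G₁ P Q G₂`, in which the entries exceeding `a` are those of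
`P` and `Q`, into two balanced ones after giving `a` an additional unit of weight. -/
theorem balanced_split_iff {w w' : V → ℤ} {a : V} {G₁ P Q G₂ : List V}
    (hG : G₁ = [] ∨ G₂ = []) (hP : ∀ x ∈ P, a < x) (hQ : ∀ x ∈ Q, a < x)
    (hG₁ : ∀ x ∈ G₁, x < a) (hG₂ : ∀ x ∈ G₂, x < a) (hwa : w' a = w a + 1)
    (hw : ∀ x, x ≠ a → w' x = w x) (hb : Balanced w (a :: (G₁ ++ (P ++ Q) ++ G₂))) :
    Balanced w' (a :: (Q ++ G₂)) ∧ Balanced w' (G₁ ++ P) ↔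
      Parks w P ∧ Parks w Q ∧ (P.map w).sum = 1 - (G₁.map w).sum := by
  have hs := hb.1
  have hp := hb.2
  have cP : ∀ x ∈ P, w' x = w x := fun x hx => hw x (hP x hx).ne'
  have cQ : ∀ x ∈ Q, w' x = w x := fun x hx => hw x (hQ x hx).ne'
  have c1 : ∀ x ∈ G₁, w' x = w x := fun x hx => hw x (hG₁ x hx).ne
  have c2 : ∀ x ∈ G₂, w' x = w x := fun x hx => hw x (hG₂ x hx).ne
  have eA : ∀ x ∈ Q, sumFrom w' x (a :: (Q ++ G₂)) = sumFrom w x Q := by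
    intro x hx
    rw [sumFrom_cons, if_neg (not_le.2 (hQ x hx)), sumFrom_append, sumFrom_congr cQ,
      sumFrom_eq_zero (l := G₂) fun y hy => (hG₂ y hy).trans (hQ x hx)]
    ring
  have eB : ∀ x ∈ P, sumFrom w' x (G₁ ++ P) = sumFrom w x P := by
    intro x hx
    rw [sumFrom_append, sumFrom_congr cP,
      sumFrom_eq_zero (l := G₁) fun y hy => (hG₁ y hy).trans (hP x hx)]
    ring
  have sA : ((a :: (Q ++ G₂)).map w').sum = w a + 1 + (Q.map w).sum + (G₂.map w).sum := by
    simp only [List.map_cons, List.map_append, List.sum_cons, List.sum_append,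
      List.map_congr_left cQ, List.map_congr_left c2, hwa]
    ring
  have sB : ((G₁ ++ P).map w').sum = (G₁.map w).sum + (P.map w).sum := by
    simp only [List.map_append, List.sum_append, List.map_congr_left cP, List.map_congr_left c1]
  simp only [List.map_cons, List.map_append, List.sum_cons, List.sum_append] at hs
  constructor
  · rintro ⟨⟨-, hA⟩, ⟨hB', hB⟩⟩
    refine ⟨fun x hx => ?_, fun x hx => ?_, by rw [sB] at hB'; omega⟩
    · rw [← eB x hx]; exact hB x (by simp [hx])
    · rw [← eA x hx]; exact hA x (by simp [hx])
  · rintro ⟨hPp, hQp, ht⟩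
    have key : ∀ x ≤ a, x ∈ a :: (G₁ ++ (P ++ Q) ++ G₂) →
        1 ≤ sumFrom w' x (a :: (Q ++ G₂)) + sumFrom w' x (G₁ ++ P) - 1 := by
      intro x hx hmem
      have := hp x hmem
      simp only [sumFrom_cons, sumFrom_append, if_pos hx, sumFrom_congr cP, sumFrom_congr cQ,
        sumFrom_congr c1, sumFrom_congr c2, hwa] at this ⊢
      omega
    have one : ∀ x ≤ a, G₁ = [] → sumFrom w' x (G₁ ++ P) = 1 := by
      rintro x hx rfl
      rw [sumFrom_eq_sum, sB, ht]
      · simp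
      · intro y hy
        exact hx.trans (hP y (by simpa using hy)).le
    have two : ∀ x ≤ a, G₂ = [] → sumFrom w' x (a :: (Q ++ G₂)) = 1 := by
      rintro x hx rfl
      rw [sumFrom_eq_sum, sA]
      · simp at hs ⊢; omega
      · intro y hy
        simp only [List.append_nil, List.mem_cons] at hy
        rcases hy with rfl | hy
        · exact hx
        · exact hx.trans (hQ y hy).le
    refine ⟨⟨by rw [sA]; omega, fun x hx => ?_⟩, ⟨by rw [sB]; omega, fun x hx => ?_⟩⟩
    · by_cases hxQ : x ∈ Q
      · rw [eA x hxQ]; exact hQp x hxQ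
      have hx' : x ∈ G₂ ∨ x = a := by
        simp only [List.mem_cons, List.mem_append] at hx; tauto
      have hxa : x ≤ a := by
        rcases hx' with h | rfl
        · exact (hG₂ x h).le
        · exact le_rfl
      rcases hG with h | h
      · have := key x hxa (by simp only [List.mem_cons, List.mem_append] at hx ⊢; tauto)
        have := one x hxa h
        omega
      · rw [two x hxa h]
    · by_cases hxP : x ∈ P
      · rw [eB x hxP]; exact hPp x hxP
      have hx' : x ∈ G₁ := by
        simp only [List.mem_append] at hx; tauto
      have hxa := (hG₁ x hx').le
      rcases hG with rfl | h
      · simp at hx'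
      · have := key x hxa (by simp only [List.mem_cons, List.mem_append] at hx ⊢; tauto)
        have := two x hxa h
        omega

/-- Around an entry `a` of a cyclic list without valleys, the entries exceeding `a` are
contiguous, and all on one side of `a`. -/
theorem Valleyless.exists_blocks {P Q : List V} {a : V} (hn : (P ++ a :: Q).Nodup)
    (hv : Valleyless (P ++ a :: Q)) :
    ∃ G₁ H G₂ : List V, Q ++ P = G₁ ++ H ++ G₂ ∧ (G₁ = [] ∨ G₂ = []) ∧ Valleyless H ∧
      (∀ x ∈ H, a < x) ∧ (∀ x ∈ G₁, x < a) ∧ ∀ x ∈ G₂, x < a := by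
  have hne : ∀ x ∈ P ++ Q, x ≠ a := by
    rintro x hx rfl
    exact (List.nodup_middle.1 hn).notMem hx
  by_cases h : ∃ p ∈ P, a < p
  · obtain ⟨p, hp, hap⟩ := h
    have hQ : ∀ q ∈ Q, q < a := by
      intro q hq
      refine lt_of_le_of_ne (not_lt.1 (hv p a q ?_ hap)) (hne q (by simp [hq]))
      exact (List.singleton_sublist.2 hp).append
        (List.cons_sublist_cons.2 (List.singleton_sublist.2 hq))
    refine ⟨Q ++ P.takeWhile (· < a), P.dropWhile (· < a), [], by simp, Or.inr rfl,
      hv.sublist ((List.dropWhile_sublist _).trans (List.sublist_append_left _ _)), ?_, ?_, by simp⟩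
    · intro x hx
      by_contra hxa
      have hxa : x < a := lt_of_le_of_ne (not_lt.1 hxa)
        (hne x (by simp [(List.dropWhile_sublist _).subset hx]))
      obtain ⟨y, L, hL⟩ := List.exists_cons_of_ne_nil (List.ne_nil_of_mem hx)
      have hy : ¬ y < a := by
        have := List.head_dropWhile_not (· < a) (l := P) (by rw [hL]; simp)
        simpa [hL] using this
      rw [hL] at hx
      have hxL : x ∈ L := by
        rcases List.mem_cons.1 hx with rfl | h
        · exact absurd hxa hy
        · exact h
      refine hv y x a ?_ (hxa.trans_le (not_lt.1 hy)) hxa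
      have h1 : [y, x].Sublist P := by
        refine List.Sublist.trans ?_ (List.dropWhile_sublist (· < a))
        rw [hL]
        exact List.cons_sublist_cons.2 (List.singleton_sublist.2 hxL)
      exact h1.append (List.cons_sublist_cons.2 (List.nil_sublist Q))
    · intro x hx
      rcases List.mem_append.1 hx with h | h
      · exact hQ x h
      · simpa using List.mem_takeWhile_imp h
  · push Not at h
    have hP : ∀ p ∈ P, p < a := fun p hp => lt_of_le_of_ne (h p hp) (hne p (by simp [hp]))
    refine ⟨[], Q.takeWhile (a < ·), Q.dropWhile (a < ·) ++ P, by
        rw [List.nil_append, ← List.append_assoc, List.takeWhile_append_dropWhile], Or.inl rfl,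
      hv.sublist ((List.takeWhile_sublist _).trans ((List.sublist_cons_self a Q).trans
        (List.sublist_append_right P _))), ?_, by simp, ?_⟩
    · intro x hx
      simpa using List.mem_takeWhile_imp hx
    · intro x hx
      rcases List.mem_append.1 hx with hx | hx
      swap
      · exact hP x hx
      by_contra hxa
      have hxa : a < x := lt_of_le_of_ne (not_lt.1 hxa)
        (hne x (by simp [(List.dropWhile_sublist _).subset hx])).symm
      obtain ⟨y, L, hL⟩ := List.exists_cons_of_ne_nil (List.ne_nil_of_mem hx)
      have hy : ¬ a < y := by
        have := List.head_dropWhile_not (a < ·) (l := Q) (by rw [hL]; simp)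
        simpa [hL] using this
      have hyQ : y ∈ Q := (List.dropWhile_sublist (a < ·)).subset (by rw [hL]; simp)
      rw [hL] at hx
      have hxL : x ∈ L := by
        rcases List.mem_cons.1 hx with rfl | h
        · exact absurd hxa hy
        · exact h
      have hya : y < a := lt_of_le_of_ne (not_lt.1 hy) (hne y (by simp [hyQ]))
      refine hv a y x ?_ hya (hya.trans hxa)
      have h1 : [y, x].Sublist Q := by
        refine List.Sublist.trans ?_ (List.dropWhile_sublist (a < ·))
        rw [hL]
        exact List.cons_sublist_cons.2 (List.singleton_sublist.2 hxL)
      exact (List.nil_sublist P).append (List.cons_sublist_cons.2 h1)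

end Weights

section Orbits

variable {V : Type*} {π : Equiv.Perm V}

/-- `π` maps `a` to the first entry of `L`, each entry of `L` to the next one, and the last
entry to `b`. -/
def IsPath (π : Equiv.Perm V) (a : V) (L : List V) (b : V) : Prop :=
  π a :: L.map π = L ++ [b]

/-- The list `a :: L` is a cycle of `π`, in cyclic order. -/
def IsOrbit (π : Equiv.Perm V) (a : V) (L : List V) : Prop :=
  (a :: L).Nodup ∧ IsPath π a L a

theorem isPath_append {a b c : V} {X Y : List V} :
    IsPath π a (X ++ b :: Y) c ↔ IsPath π a X b ∧ IsPath π b Y c := by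
  unfold IsPath
  have e₁ : π a :: (X ++ b :: Y).map π = (π a :: X.map π) ++ (π b :: Y.map π) := by simp
  have e₂ : X ++ b :: Y ++ [c] = (X ++ [b]) ++ (Y ++ [c]) := by simp
  rw [e₁, e₂]
  exact ⟨fun h => List.append_inj h (by simp), fun h => by rw [h.1, h.2]⟩

theorem IsPath.congr {π' : Equiv.Perm V} {a a' b : V} {L : List V} (h : IsPath π a L b)
    (ha : π' a' = π a) (hL : ∀ x ∈ L, π' x = π x) : IsPath π' a' L b := by
  unfold IsPath at *
  rw [ha, List.map_congr_left hL, h]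

theorem IsOrbit.rotate {a b : V} {X Y : List V} (h : IsOrbit π a (X ++ b :: Y)) :
    IsOrbit π b (Y ++ a :: X) := by
  refine ⟨?_, isPath_append.2 (isPath_append.1 h.2).symm⟩
  refine (List.Perm.nodup_iff ?_).1 h.1
  exact List.perm_append_comm (l₁ := a :: X) (l₂ := b :: Y)

theorem IsOrbit.congr {π' : Equiv.Perm V} {a : V} {L : List V} (h : IsOrbit π a L)
    (hL : ∀ x ∈ a :: L, π' x = π x) : IsOrbit π' a L :=
  ⟨h.1, h.2.congr (hL a (by simp)) fun x hx => hL x (by simp [hx])⟩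

theorem IsOrbit.map_perm {a : V} {L : List V} (h : IsOrbit π a L) :
    ((a :: L).map π).Perm (a :: L) := by
  rw [List.map_cons, h.2]
  exact List.perm_append_singleton a L

theorem IsOrbit.apply_mem_iff {a x : V} {L : List V} (h : IsOrbit π a L) :
    π x ∈ a :: L ↔ x ∈ a :: L := by
  rw [← h.map_perm.mem_iff, List.mem_map_of_injective π.injective]

theorem IsPath.sameCycle {a b : V} {L : List V} (h : IsPath π a L b) : π.SameCycle a b := by
  induction L generalizing a with
  | nil =>
    simp only [IsPath, List.map_nil, List.nil_append, List.cons.injEq, and_true] at h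
    exact ⟨1, by simpa using h⟩
  | cons c L ih =>
    obtain ⟨h₁, h₂⟩ := isPath_append (X := []).1 h
    simp only [IsPath, List.map_nil, List.nil_append, List.cons.injEq, and_true] at h₁
    exact (show π.SameCycle a c from ⟨1, by simpa using h₁⟩).trans (ih h₂)

theorem IsOrbit.sameCycle {a x : V} {L : List V} (h : IsOrbit π a L) (hx : x ∈ a :: L) :
    π.SameCycle a x := by
  rcases List.mem_cons.1 hx with rfl | hx
  · exact Equiv.Perm.SameCycle.refl _ _
  · obtain ⟨X, Y, rfl⟩ := List.append_of_mem hx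
    exact (isPath_append.1 h.2).1.sameCycle

theorem exists_isOrbit_range [Finite V] (π : Equiv.Perm V) (a : V) :
    ∃ p, IsOrbit π a ((List.range p).map fun k => (π ^ (k + 1)) a) ∧
      (a :: (List.range p).map fun k => (π ^ (k + 1)) a) =
        (List.range (p + 1)).map fun k => (π ^ k) a := by
  have hp : 0 < Function.minimalPeriod π a :=
    Function.minimalPeriod_pos_of_mem_periodicPts (π.injective.mem_periodicPts a)
  obtain ⟨p, hp'⟩ := Nat.exists_eq_succ_of_ne_zero hp.ne'
  have hcons : (a :: (List.range p).map fun k => (π ^ (k + 1)) a) =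
      (List.range (p + 1)).map fun k => (π ^ k) a := by
    rw [List.range_succ_eq_map, List.map_cons, List.map_map]; rfl
  refine ⟨p, ⟨?_, ?_⟩, hcons⟩
  · rw [hcons]
    refine List.Nodup.map_on (fun i hi j hj hij => ?_) List.nodup_range
    rw [List.mem_range] at hi hj
    simp only [Equiv.Perm.coe_pow] at hij
    refine (Function.iterate_injOn_Iio_minimalPeriod (f := π) (x := a)) ?_ ?_ hij <;>
      simp [hp', hi, hj]
  · have e : (π ^ (p + 1)) a = a := by
      have := Function.iterate_minimalPeriod (f := π) (x := a)
      rwa [hp', ← Equiv.Perm.coe_pow] at this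
    unfold IsPath
    rw [List.map_map]
    calc _ = (List.range (p + 1)).map fun k => (π ^ (k + 1)) a := by
            rw [List.range_succ_eq_map, List.map_cons, List.map_map]
            congr 1
            refine List.map_congr_left fun k _ => ?_
            simp only [Function.comp_apply, Nat.succ_eq_add_one]
            rw [pow_succ' π (k + 1), Equiv.Perm.mul_apply]
      _ = _ := by rw [List.range_succ, List.map_append]; simp only [List.map_cons, List.map_nil, e]

theorem exists_isOrbit [Finite V] (π : Equiv.Perm V) (a : V) : ∃ L, IsOrbit π a L :=
  let ⟨_, h, _⟩ := exists_isOrbit_range π a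
  ⟨_, h⟩

theorem IsOrbit.mem_iff [Finite V] {a x : V} {L : List V} (h : IsOrbit π a L) :
    x ∈ a :: L ↔ π.SameCycle a x := by
  refine ⟨h.sameCycle, fun hs => ?_⟩
  obtain ⟨k, rfl⟩ := hs.exists_nat_pow_eq
  clear hs
  induction k with
  | zero => simp
  | succ k ih => rwa [pow_succ', Equiv.Perm.mul_apply, h.apply_mem_iff]

theorem IsOrbit.perm [Finite V] {a c : V} {L Z : List V} (h : IsOrbit π a L) (h' : IsOrbit π c Z)
    (hc : π.SameCycle a c) : (c :: Z).Perm (a :: L) := by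
  refine (List.perm_ext_iff_of_nodup h'.1 h.1).2 fun x => ?_
  rw [h.mem_iff, h'.mem_iff]
  exact ⟨hc.trans, hc.symm.trans⟩

theorem isOrbit_one {a : V} {L : List V} (h : IsOrbit (1 : Equiv.Perm V) a L) : L = [] := by
  have hn := h.1
  have hp := h.2
  rcases L with _ | ⟨b, L⟩
  · rfl
  · simp only [IsPath, Equiv.Perm.one_apply, List.cons_append, List.cons.injEq] at hp
    simp [hp.1] at hn

theorem apply_eq_of_sameCycle [Finite V] {α : Type*} {c : V → α} (hc : ∀ x, c (π x) = c x)
    {x y : V} (h : π.SameCycle x y) : c x = c y := by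
  obtain ⟨k, rfl⟩ := h.exists_nat_pow_eq
  clear h
  induction k with
  | zero => simp
  | succ k ih => rw [pow_succ', Equiv.Perm.mul_apply, hc, ih]

variable [DecidableEq V]

theorem swap_mul_apply {a b x : V} (π : Equiv.Perm V) (ha : x ≠ a) (hb : x ≠ b) :
    (π * Equiv.swap a b) x = π x := by
  rw [Equiv.Perm.mul_apply, Equiv.swap_apply_of_ne_of_ne ha hb]

/-- Multiplication by a transposition splits a cycle. -/
theorem IsOrbit.split {a b : V} {X Y : List V} (h : IsOrbit π a (X ++ b :: Y)) :
    IsOrbit (π * Equiv.swap a b) a Y ∧ IsOrbit (π * Equiv.swap a b) b X := by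
  obtain ⟨hn, hp⟩ := h
  rw [isPath_append] at hp
  have hn' : (a :: b :: (X ++ Y)).Nodup :=
    (List.Perm.nodup_iff (List.Perm.cons a List.perm_middle)).1 hn
  simp only [List.nodup_cons, List.mem_cons, List.mem_append, not_or] at hn'
  obtain ⟨⟨-, haX, haY⟩, ⟨hbX, hbY⟩, hXY⟩ := hn'
  refine ⟨⟨List.nodup_cons.2 ⟨haY, hXY.sublist (by simp)⟩, hp.2.congr (by simp) fun x hx => ?_⟩,
    ⟨List.nodup_cons.2 ⟨hbX, hXY.sublist (by simp)⟩, hp.1.congr (by simp) fun x hx => ?_⟩⟩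
  · exact swap_mul_apply π (fun e => haY (e ▸ hx)) fun e => hbY (e ▸ hx)
  · exact swap_mul_apply π (fun e => haX (e ▸ hx)) fun e => hbX (e ▸ hx)

/-- Multiplication by a transposition merges two cycles. -/
theorem IsOrbit.merge {a b : V} {X Y : List V} (ha : IsOrbit π a Y) (hb : IsOrbit π b X)
    (hd : (a :: Y).Disjoint (b :: X)) : IsOrbit (π * Equiv.swap a b) a (X ++ b :: Y) := by
  have hn : ((a :: Y) ++ (b :: X)).Nodup := List.nodup_append'.2 ⟨ha.1, hb.1, hd⟩
  have hperm : ((a :: Y) ++ (b :: X)).Perm (a :: (X ++ b :: Y)) := by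
    rw [List.cons_append]
    refine List.Perm.cons a (List.perm_append_comm.trans ?_)
    exact List.perm_middle.symm
  have hn' := hn
  simp only [List.cons_append, List.nodup_cons, List.mem_append, List.mem_cons, not_or] at hn'
  have haY : a ∉ Y := hn'.1.1
  have hbX : b ∉ X := (List.nodup_cons.1 hb.1).1
  refine ⟨(List.Perm.nodup_iff hperm).1 hn, isPath_append.2 ⟨hb.2.congr (by simp) fun x hx => ?_,
    ha.2.congr (by simp) fun x hx => ?_⟩⟩
  · exact swap_mul_apply π (fun e => hn'.1.2.2 (e ▸ hx)) fun e => hbX (e ▸ hx)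
  · refine swap_mul_apply π (fun e => haY (e ▸ hx)) ?_
    rintro rfl
    exact hd (List.mem_cons_of_mem _ hx) (by simp)

theorem IsOrbit.mul_swap {a b c : V} {L : List V} (h : IsOrbit π c L) (ha : a ∉ c :: L)
    (hb : b ∉ c :: L) : IsOrbit (π * Equiv.swap a b) c L :=
  h.congr fun _ hx => swap_mul_apply π (fun e => ha (e ▸ hx)) fun e => hb (e ▸ hx)

end Orbits

section Factorizations

variable {V : Type*} [LinearOrder V] {π : Equiv.Perm V}

/-- The weight counting `1` for each symbol and `-1` for each occurrence in `l`. -/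
def weight (l : List V) (x : V) : ℤ :=
  1 - l.count x

theorem weight_nil (x : V) : weight [] x = 1 := by simp [weight]

theorem weight_le_one (l : List V) (x : V) : weight l x ≤ 1 := by
  unfold weight; omega

theorem weight_cons_self (a : V) (l : List V) : weight (a :: l) a = weight l a - 1 := by
  simp only [weight, List.count_cons_self]; push_cast; ring

theorem weight_cons_of_ne {a x : V} (h : x ≠ a) (l : List V) :
    weight (a :: l) x = weight l x := by
  simp only [weight, List.count_cons_of_ne h.symm]

/-- The product of the transpositions of the listed pairs, the first one acting first. -/
def swapProd : List (V × V) → Equiv.Perm V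
  | [] => 1
  | p :: l => swapProd l * Equiv.swap p.1 p.2

@[simp] theorem swapProd_nil : swapProd ([] : List (V × V)) = 1 := rfl

@[simp] theorem swapProd_cons (p : V × V) (l : List (V × V)) :
    swapProd (p :: l) = swapProd l * Equiv.swap p.1 p.2 := rfl

theorem swapProd_append (l l' : List (V × V)) :
    swapProd (l ++ l') = swapProd l' * swapProd l := by
  induction l with
  | nil => simp
  | cons p l ih => simp [ih, mul_assoc]

/-- Each transposition of the list merges two cycles of the product of the later ones. -/
inductive IsMerging : List (V × V) → Prop
  | nil : IsMerging []
  | cons {a b : V} {l : List (V × V)} (hab : a < b) (h : ¬ (swapProd l).SameCycle a b)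
      (hl : IsMerging l) : IsMerging ((a, b) :: l)

theorem IsMerging.lt {l : List (V × V)} (h : IsMerging l) : ∀ p ∈ l, p.1 < p.2 := by
  induction h with
  | nil => simp
  | cons hab _ _ ih => exact List.forall_mem_cons.2 ⟨hab, ih⟩

/-- All cycles of `π` are balanced for `w`. -/
def OrbitsBalanced (π : Equiv.Perm V) (w : V → ℤ) : Prop :=
  ∀ a L, IsOrbit π a L → Balanced w (a :: L)

/-- All cycles of `π` can be cut to a list without valleys. -/
def OrbitsUnimodal (π : Equiv.Perm V) : Prop :=
  ∀ x, ∃ P Q, IsOrbit π x (Q ++ P) ∧ Valleyless (P ++ x :: Q)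

theorem exists_cut_of_mem {a x : V} {P Q : List V} (h : IsOrbit π a (Q ++ P))
    (hv : Valleyless (P ++ a :: Q)) (hx : x ∈ a :: (Q ++ P)) :
    ∃ P' Q', IsOrbit π x (Q' ++ P') ∧ Valleyless (P' ++ x :: Q') := by
  simp only [List.mem_cons, List.mem_append] at hx
  rcases hx with rfl | hx | hx
  · exact ⟨P, Q, h, hv⟩
  · obtain ⟨Q₁, Q₂, rfl⟩ := List.append_of_mem hx
    refine ⟨P ++ a :: Q₁, Q₂, ?_, by simpa using hv⟩
    rw [List.append_assoc, List.cons_append] at h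
    simpa using h.rotate
  · obtain ⟨P₁, P₂, rfl⟩ := List.append_of_mem hx
    refine ⟨P₁, P₂ ++ a :: Q, ?_, by simpa using hv⟩
    rw [← List.append_assoc] at h
    simpa using h.rotate

theorem OrbitsUnimodal.mul_swap [Finite V] (hπ : OrbitsUnimodal π) {a b : V} (hab : a ≠ b)
    (h : π.SameCycle a b) : OrbitsUnimodal (π * Equiv.swap a b) := by
  obtain ⟨P, Q, ho, hv⟩ := hπ a
  intro x
  by_cases hx : x ∈ a :: (Q ++ P)
  swap
  · obtain ⟨P', Q', ho', hv'⟩ := hπ x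
    have hax : ¬ π.SameCycle x a := fun h' => hx (ho.mem_iff.2 h'.symm)
    exact ⟨P', Q', ho'.mul_swap (fun h' => hax (ho'.mem_iff.1 h'))
      fun h' => hax ((ho'.mem_iff.1 h').trans h.symm), hv'⟩
  have hb := ho.mem_iff.2 h
  simp only [List.mem_cons, List.mem_append, hab.symm, false_or] at hb
  rcases hb with hb | hb
  · obtain ⟨Q₁, Q₂, rfl⟩ := List.append_of_mem hb
    rw [List.append_assoc, List.cons_append] at ho hx
    obtain ⟨h₁, h₂⟩ := ho.split
    have hx : x ∈ a :: (Q₂ ++ P) ∨ x ∈ b :: Q₁ := by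
      simp only [List.mem_cons, List.mem_append] at hx ⊢; tauto
    rcases hx with hx | hx
    · refine exists_cut_of_mem h₁ (hv.sublist ?_) hx
      simp
    · refine exists_cut_of_mem (P := Q₁) (Q := []) (by simpa using h₂) (hv.sublist ?_)
        (by simpa using hx)
      exact ((List.Sublist.refl Q₁).append (List.singleton_sublist.2 (by simp))).trans
        ((List.sublist_cons_self _ _).trans (List.sublist_append_right _ _))
  · obtain ⟨P₁, P₂, rfl⟩ := List.append_of_mem hb
    rw [← List.append_assoc] at ho hx
    obtain ⟨h₁, h₂⟩ := ho.split
    have hx : x ∈ a :: P₂ ∨ x ∈ b :: (Q ++ P₁) := by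
      simp only [List.mem_cons, List.mem_append] at hx ⊢; tauto
    rcases hx with hx | hx
    · refine exists_cut_of_mem (P := P₂) (Q := []) (by simpa using h₁) (hv.sublist ?_)
        (by simpa using hx)
      exact ((List.sublist_cons_self b P₂).trans (List.sublist_append_right P₁ _)).append
        (List.singleton_sublist.2 (by simp))
    · refine exists_cut_of_mem h₂ (hv.sublist ?_) hx
      rw [List.append_cons P₁ b Q]
      exact ((List.Sublist.refl P₁).append (List.singleton_sublist.2 (by simp))).append
        (List.sublist_cons_self a Q)

theorem OrbitsBalanced.merge [Finite V] {w w' : V → ℤ} {a b : V} (h : OrbitsBalanced π w)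
    (hab : a < b) (hc : ¬ π.SameCycle a b) (hwa : w' a = w a - 1)
    (hw : ∀ x, x ≠ a → w' x = w x) : OrbitsBalanced (π * Equiv.swap a b) w' := by
  obtain ⟨Y, hY⟩ := exists_isOrbit π a
  obtain ⟨X, hX⟩ := exists_isOrbit π b
  have hd : (a :: Y).Disjoint (b :: X) := fun x h₁ h₂ =>
    hc ((hY.mem_iff.1 h₁).trans (hX.mem_iff.1 h₂).symm)
  have hm := hY.merge hX hd
  have bY := h _ _ hY
  have bX := h _ _ hX
  have cY : ∀ x ∈ Y, w' x = w x := fun x hx =>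
    hw x (by rintro rfl; exact (List.nodup_cons.1 hY.1).1 hx)
  have cX : ∀ x ∈ b :: X, w' x = w x := fun x hx =>
    hw x (by rintro rfl; exact hd (by simp) hx)
  have hperm : (a :: (X ++ b :: Y)).Perm (a :: Y ++ b :: X) := by
    rw [List.cons_append]
    refine List.Perm.cons a (List.perm_middle.trans ?_)
    exact (List.Perm.cons b List.perm_append_comm).trans List.perm_middle.symm
  intro c Z hZ
  by_cases hca : (π * Equiv.swap a b).SameCycle a c
  · refine Balanced.perm ?_ ((hm.perm hZ hca).trans hperm).symm
    refine ⟨?_, fun x hx => ?_⟩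
    · have h₁ := bY.1
      have h₂ := bX.1
      rw [List.map_append, List.sum_append, List.map_congr_left cX, h₂, List.map_cons,
        List.map_congr_left cY, List.sum_cons, hwa]
      rw [List.map_cons, List.sum_cons] at h₁
      omega
    · rw [sumFrom_append, sumFrom_congr cX, sumFrom_cons, sumFrom_congr cY, hwa]
      by_cases hxa : x ≤ a
      · have h₁ := bY.2.one_le_sumFrom (List.mem_cons_self ..) hxa
        have h₂ := bX.2.one_le_sumFrom (List.mem_cons_self ..) (hxa.trans hab.le)
        rw [sumFrom_cons, if_pos hxa] at h₁
        rw [if_pos hxa]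
        omega
      · have e : sumFrom w x (a :: Y) = sumFrom w x Y := by simp [hxa]
        rw [if_neg hxa, zero_add, ← e]
        have h₁ := bY.2.sumFrom_nonneg x
        have h₂ := bX.2.sumFrom_nonneg x
        rcases List.mem_append.1 hx with hx | hx
        · have := bY.2 x hx
          omega
        · have := bX.2 x hx
          omega
  · have hac : a ∉ c :: Z := fun h' => hca (hZ.sameCycle h').symm
    have hbc : b ∉ c :: Z := fun h' => hca
      ((hm.sameCycle (by simp)).trans (hZ.sameCycle h').symm)
    have hZ' : IsOrbit π c Z := by
      have := hZ.mul_swap hac hbc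
      rwa [mul_assoc, Equiv.swap_mul_self, mul_one] at this
    refine (h _ _ hZ').congr fun x hx => (hw x ?_).symm
    rintro rfl
    exact hac hx

theorem IsMerging.orbitsBalanced [Finite V] {l : List (V × V)} (h : IsMerging l) :
    OrbitsBalanced (swapProd l) (weight (l.map Prod.fst)) := by
  induction h with
  | nil =>
    intro a L hL
    obtain rfl := isOrbit_one hL
    refine ⟨by simp [weight_nil], fun x hx => ?_⟩
    simp only [List.mem_singleton] at hx
    simp [hx, weight_nil]
  | cons hab h _ ih =>
    exact ih.merge hab h (weight_cons_self _ _) fun x hx => weight_cons_of_ne hx _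

theorem OrbitsBalanced.split [Finite V] {w w' : V → ℤ} {a b : V} {X Y : List V}
    (h : OrbitsBalanced π w) (ho : IsOrbit π a (X ++ b :: Y)) (hw : ∀ x, x ≠ a → w' x = w x)
    (hY : Balanced w' (a :: Y)) (hX : Balanced w' (b :: X)) :
    OrbitsBalanced (π * Equiv.swap a b) w' := by
  obtain ⟨h₁, h₂⟩ := ho.split
  intro c Z hZ
  by_cases hac : a ∈ c :: Z
  · exact hY.perm (h₁.perm hZ (hZ.sameCycle hac).symm).symm
  by_cases hbc : b ∈ c :: Z
  · exact hX.perm (h₂.perm hZ (hZ.sameCycle hbc).symm).symm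
  have hZ' : IsOrbit π c Z := by
    have := hZ.mul_swap hac hbc
    rwa [mul_assoc, Equiv.swap_mul_self, mul_one] at this
  refine (h _ _ hZ').congr fun x hx => (hw x ?_).symm
  rintro rfl
  exact hac hx

theorem exists_transposition [Finite V] {w w' : V → ℤ} {a : V} (hπ : OrbitsUnimodal π)
    (hb : OrbitsBalanced π w) (hle : ∀ x, w x ≤ 1) (ha : w a ≤ 0) (hwa : w' a = w a + 1)
    (hw : ∀ x, x ≠ a → w' x = w x) :
    ∃ b, a < b ∧ π.SameCycle a b ∧ ¬ (π * Equiv.swap a b).SameCycle a b ∧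
      OrbitsBalanced (π * Equiv.swap a b) w' := by
  obtain ⟨P, Q, ho, hv⟩ := hπ a
  have hn : (P ++ a :: Q).Nodup :=
    (List.Perm.nodup_iff (List.perm_append_comm (l₁ := a :: Q) (l₂ := P))).1 ho.1
  obtain ⟨G₁, H, G₂, e, hG, hvH, hH, hG₁, hG₂⟩ := hv.exists_blocks hn
  rw [e] at ho
  have hbal := hb _ _ ho
  have hnH : H.Nodup := ho.1.sublist (((List.sublist_append_right G₁ H).trans
    (List.sublist_append_left _ G₂)).cons a)
  have hpH : Parks w H := by
    intro x hx
    have := hbal.2 x (by simp [hx])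
    rwa [sumFrom_cons, if_neg (not_le.2 (hH x hx)), sumFrom_append, sumFrom_append,
      sumFrom_eq_zero (l := G₁) fun y hy => (hG₁ y hy).trans (hH x hx),
      sumFrom_eq_zero (l := G₂) fun y hy => (hG₂ y hy).trans (hH x hx), zero_add, zero_add,
      add_zero] at this
  have ht : 1 ≤ 1 - (G₁.map w).sum ∧ 1 - (G₁.map w).sum ≤ (H.map w).sum := by
    have h₁ := hbal.1
    have h₂ := hbal.2 a (by simp)
    rw [sumFrom_cons, if_pos le_rfl, sumFrom_append, sumFrom_append, sumFrom_eq_zero hG₁,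
      sumFrom_eq_zero hG₂, sumFrom_eq_sum fun y hy => (hH y hy).le] at h₂
    simp only [List.map_cons, List.map_append, List.sum_cons, List.sum_append] at h₁
    rcases hG with rfl | rfl <;> simp only [List.map_nil, List.sum_nil] at h₁ ⊢ <;> omega
  obtain ⟨R, S, rfl, hR, hS, hs⟩ := exists_split hle H hnH hvH hpH (by omega) ht.2
  have hRS := (balanced_split_iff hG (fun x hx => hH x (by simp [hx]))
    (fun x hx => hH x (by simp [hx])) hG₁ hG₂ hwa hw hbal).2 ⟨hR, hS, hs⟩
  rcases List.eq_nil_or_concat' R with rfl | ⟨X, b, rfl⟩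
  · simp only [List.map_nil, List.sum_nil] at hs
    omega
  have ho' : IsOrbit π a ((G₁ ++ X) ++ b :: (S ++ G₂)) := by simpa using ho
  refine ⟨b, hH b (by simp), ho'.sameCycle (by simp), fun hab => ?_,
    hb.split ho' hw hRS.1 (hRS.2.perm ?_)⟩
  · have := ho'.split.1.mem_iff.2 hab
    have hn := ho'.1
    simp only [List.nodup_cons, List.nodup_append, List.mem_cons, List.mem_append] at this hn
    grind
  · rw [← List.append_assoc]
    exact List.perm_append_singleton _ _

theorem transposition_unique [Finite V] {w w' : V → ℤ} {a b b' : V} (hπ : OrbitsUnimodal π)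
    (hb : OrbitsBalanced π w) (hwa : w' a = w a + 1) (hw : ∀ x, x ≠ a → w' x = w x)
    (hab : a < b) (hc : π.SameCycle a b) (hs : OrbitsBalanced (π * Equiv.swap a b) w')
    (hab' : a < b') (hc' : π.SameCycle a b')
    (hs' : OrbitsBalanced (π * Equiv.swap a b') w') : b = b' := by
  obtain ⟨P, Q, ho, hv⟩ := hπ a
  have hn : (P ++ a :: Q).Nodup :=
    (List.Perm.nodup_iff (List.perm_append_comm (l₁ := a :: Q) (l₂ := P))).1 ho.1
  obtain ⟨G₁, H, G₂, e, hG, hvH, hH, hG₁, hG₂⟩ := hv.exists_blocks hn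
  rw [e] at ho
  have hbal := hb _ _ ho
  have hnH : H.Nodup := ho.1.sublist (((List.sublist_append_right G₁ H).trans
    (List.sublist_append_left _ G₂)).cons a)
  have key : ∀ c, a < c → π.SameCycle a c → OrbitsBalanced (π * Equiv.swap a c) w' →
      ∃ X S, (X ++ [c]) ++ S = H ∧ Parks w (X ++ [c]) ∧ Parks w S ∧
        ((X ++ [c]).map w).sum = 1 - (G₁.map w).sum := by
    intro c hac hcc hsc
    have hcH : c ∈ H := by
      have := ho.mem_iff.2 hcc
      simp only [List.mem_cons, List.mem_append] at this
      rcases this with rfl | (h | h) | h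
      · exact absurd hac (lt_irrefl _)
      · exact absurd (hG₁ c h) hac.asymm
      · exact h
      · exact absurd (hG₂ c h) hac.asymm
    obtain ⟨X, S, rfl⟩ := List.append_of_mem hcH
    have ho' : IsOrbit π a ((G₁ ++ X) ++ c :: (S ++ G₂)) := by simpa using ho
    obtain ⟨h₁, h₂⟩ := ho'.split
    refine ⟨X, S, by simp, (balanced_split_iff hG (fun x hx => hH x ?_)
      (fun x hx => hH x ?_) hG₁ hG₂ hwa hw ?_).1 ⟨hsc _ _ h₁, (hsc _ _ h₂).perm ?_⟩⟩
    · simp only [List.mem_append, List.mem_cons] at hx ⊢; tauto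
    · simp [hx]
    · simpa using hbal
    · rw [← List.append_assoc]
      exact (List.perm_append_singleton _ _).symm
  obtain ⟨X, S, h₁, h₂, h₃, h₄⟩ := key b hab hc hs
  obtain ⟨X', S', h₁', h₂', h₃', h₄'⟩ := key b' hab' hc' hs'
  have := split_unique H hnH hvH h₁ h₂ h₃ h₁' h₂' h₃' (h₄.trans h₄'.symm)
  simpa using (List.append_inj' this rfl).2

theorem sameCycle_mul_swap [Finite V] {a b : V} (h : ¬ π.SameCycle a b) :
    (π * Equiv.swap a b).SameCycle a b := by
  obtain ⟨Y, hY⟩ := exists_isOrbit π a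
  obtain ⟨X, hX⟩ := exists_isOrbit π b
  exact (hY.merge hX fun x h₁ h₂ => h ((hY.mem_iff.1 h₁).trans (hX.mem_iff.1 h₂).symm)).sameCycle
    (by simp)

theorem exists_isMerging [Finite V] (l : List V) (hπ : OrbitsUnimodal π)
    (hb : OrbitsBalanced π (weight l)) :
    ∃ f, IsMerging f ∧ swapProd f = π ∧ f.map Prod.fst = l := by
  induction l generalizing π with
  | nil =>
    refine ⟨[], .nil, ?_, rfl⟩
    ext x
    obtain ⟨L, hL⟩ := exists_isOrbit π x
    have := (hb _ _ hL).1
    rw [List.map_congr_left (g := fun _ => 1) fun x _ => weight_nil x] at this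
    have hlen : L = [] := by simpa using this
    subst hlen
    have := hL.2
    simp only [IsPath, List.map_nil, List.nil_append, List.cons.injEq, and_true] at this
    simp [this]
  | cons a l ih =>
    obtain ⟨b, hab, hc, hc', hb'⟩ := exists_transposition (w' := weight l) (a := a) hπ hb
      (weight_le_one _) (by rw [weight_cons_self]; have := weight_le_one l a; omega)
      (by rw [weight_cons_self]; omega) fun x hx => (weight_cons_of_ne hx l).symm
    obtain ⟨f, hf, hp, rfl⟩ := ih (hπ.mul_swap hab.ne hc) hb'
    refine ⟨(a, b) :: f, .cons hab (by rwa [hp]) hf, ?_, rfl⟩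
    rw [swapProd_cons, hp, mul_assoc, Equiv.swap_mul_self, mul_one]

theorem isMerging_unique [Finite V] {f g : List (V × V)} (hf : IsMerging f) (hg : IsMerging g)
    (hπ : OrbitsUnimodal (swapProd f)) (hp : swapProd f = swapProd g)
    (hfst : f.map Prod.fst = g.map Prod.fst) : f = g := by
  induction hf generalizing g with
  | nil => simpa using hfst.symm
  | @cons a b l hab hc hl ih =>
    rcases hg with _ | @⟨a', b', l', hab', hc', hl'⟩
    · simp at hfst
    simp only [List.map_cons, List.cons.injEq] at hfst
    obtain ⟨rfl, hfst⟩ := hfst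
    have e : swapProd ((a, b) :: l) * Equiv.swap a b = swapProd l := by
      rw [swapProd_cons, mul_assoc, Equiv.swap_mul_self, mul_one]
    have e' : swapProd ((a, b) :: l) * Equiv.swap a b' = swapProd l' := by
      rw [hp, swapProd_cons, mul_assoc, Equiv.swap_mul_self, mul_one]
    have hbal := (IsMerging.cons hab hc hl).orbitsBalanced
    have hcyc := sameCycle_mul_swap hc
    obtain rfl : b = b' := by
      refine transposition_unique (w' := weight (l.map Prod.fst)) hπ hbal ?_ ?_ hab hcyc ?_
        hab' ?_ ?_
      · simp only [List.map_cons, weight_cons_self]; omega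
      · exact fun x hx => (weight_cons_of_ne hx _).symm
      · rw [e]; exact hl.orbitsBalanced
      · rw [hp]; exact sameCycle_mul_swap hc'
      · rw [e', hfst]; exact hl'.orbitsBalanced
    rw [ih hl' (by rw [← e]; exact hπ.mul_swap hab.ne hcyc) (e.symm.trans e') hfst]

/-- A product of transpositions leaves a classification of the symbols with at least
`|V| - length` classes invariant, with more than that many unless all transpositions merge. -/
theorem exists_invariant [Fintype V] (l : List (V × V)) (hl : ∀ p ∈ l, p.1 < p.2) :
    ∃ c : V → V, (∀ x, c (swapProd l x) = c x) ∧
      Fintype.card V ≤ (Finset.univ.image c).card + l.length ∧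
      (IsMerging l ∨ Fintype.card V < (Finset.univ.image c).card + l.length) := by
  induction l with
  | nil => exact ⟨id, by simp, by simp, Or.inl .nil⟩
  | cons p l ih =>
    obtain ⟨a, b⟩ := p
    obtain ⟨c, hc, hcard, hm⟩ := ih fun p hp => hl p (by simp [hp])
    by_cases hab : c a = c b
    · refine ⟨c, fun x => ?_, by simp; omega, Or.inr (by simp; omega)⟩
      rw [swapProd_cons, Equiv.Perm.mul_apply, hc]
      by_cases hxa : x = a
      · rw [hxa, Equiv.swap_apply_left, hab]
      by_cases hxb : x = b
      · rw [hxb, Equiv.swap_apply_right, hab]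
      rw [Equiv.swap_apply_of_ne_of_ne hxa hxb]
    · have himg : (Finset.univ.image c).card ≤
          (Finset.univ.image fun x => if c x = c b then c a else c x).card + 1 := by
        refine (Finset.card_le_card (t := insert (c b)
          (Finset.univ.image fun x => if c x = c b then c a else c x)) ?_).trans
          (Finset.card_insert_le _ _)
        intro y hy
        obtain ⟨x, -, rfl⟩ := Finset.mem_image.1 hy
        by_cases hx : c x = c b
        · simp [hx]
        · exact Finset.mem_insert_of_mem (Finset.mem_image.2 ⟨x, by simp, by simp [hx]⟩)
      refine ⟨fun x => if c x = c b then c a else c x, fun x => ?_, by simp; omega, ?_⟩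
      · simp only [swapProd_cons, Equiv.Perm.mul_apply, hc]
        by_cases hxa : x = a
        · simp [hxa]
        by_cases hxb : x = b
        · simp [hxb]
        rw [Equiv.swap_apply_of_ne_of_ne hxa hxb]
      · refine hm.imp (fun hm => .cons (hl (a, b) (by simp)) ?_ hm) fun h => by simp; omega
        intro hs
        exact hab (apply_eq_of_sameCycle hc hs)

theorem isMerging_of_forall_sameCycle [Fintype V] {l : List (V × V)} (hl : ∀ p ∈ l, p.1 < p.2)
    (hlen : l.length + 1 = Fintype.card V) (h : ∀ x y, (swapProd l).SameCycle x y) :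
    IsMerging l := by
  obtain ⟨c, hc, -, hm⟩ := exists_invariant l hl
  refine hm.resolve_right fun hlt => ?_
  have : (Finset.univ.image c).card ≤ 1 := by
    refine Finset.card_le_one.2 fun y hy z hz => ?_
    obtain ⟨x, -, rfl⟩ := Finset.mem_image.1 hy
    obtain ⟨x', -, rfl⟩ := Finset.mem_image.1 hz
    rw [apply_eq_of_sameCycle hc (h x x')]
  omega

end Factorizations

section Star

variable {V : Type*} [LinearOrder V] {π : Equiv.Perm V}

theorem swapProd_star {z : V} {L : List V} (h : IsOrbit π z L) (hfix : ∀ x, x ∉ z :: L → π x = x) :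
    swapProd (L.map fun x => (z, x)) = π := by
  induction L generalizing π with
  | nil =>
    ext x
    by_cases hx : x = z
    · have := h.2
      simp only [IsPath, List.map_nil, List.nil_append, List.cons.injEq, and_true] at this
      simp [hx, this]
    · simp [hfix x (by simpa using hx)]
  | cons b L ih =>
    obtain ⟨h₁, h₂⟩ := IsOrbit.split (X := []) h
    rw [List.map_cons, swapProd_cons, ih h₁, mul_assoc, Equiv.swap_mul_self, mul_one]
    intro x hx
    by_cases hxb : x = b
    · subst hxb
      simpa [IsPath] using h₂.2
    · have hxz : x ≠ z := by rintro rfl; simp at hx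
      rw [swap_mul_apply π hxz hxb]
      exact hfix x (by simp only [List.mem_cons] at hx ⊢; tauto)

theorem swapProd_exchange {z b c d : V} (hzb : z ≠ b) (hzd : z ≠ d) (hbc : b ≠ c)
    (hbd : b ≠ d) (hcd : c ≠ d) :
    swapProd [(b, c), (z, c), (z, d)] = swapProd [(z, c), (z, b), (z, d)] ∧
      swapProd [(b, d), (z, c), (z, b)] = swapProd [(z, c), (z, b), (z, d)] := by
  simp only [swapProd_cons, swapProd_nil, one_mul]
  constructor
  · rw [mul_assoc, Equiv.mul_swap_eq_swap_mul (Equiv.swap z c), Equiv.swap_apply_right,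
      Equiv.swap_apply_of_ne_of_ne hzb.symm hbc, Equiv.swap_comm b z, mul_assoc]
  · rw [Equiv.mul_swap_eq_swap_mul (Equiv.swap z b * Equiv.swap z c), Equiv.Perm.mul_apply,
      Equiv.Perm.mul_apply, Equiv.swap_apply_of_ne_of_ne hzb.symm hbc, Equiv.swap_apply_right,
      Equiv.swap_apply_of_ne_of_ne hzd.symm hcd.symm,
      Equiv.swap_apply_of_ne_of_ne hzd.symm hbd.symm, mul_assoc]

/-- A valley of a cycle yields two minimal factorizations with equal lower sequences. -/
theorem exists_collision {z b c d : V} {P Q : List V} (h : IsOrbit π z (P ++ c :: b :: d :: Q))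
    (hfix : ∀ x, x ∉ z :: (P ++ c :: b :: d :: Q) → π x = x)
    (hz : ∀ x ∈ P ++ c :: b :: d :: Q, z < x) (hbc : b < c) (hbd : b < d) :
    ∃ f g : List (V × V), f ≠ g ∧ f.map Prod.fst = g.map Prod.fst ∧
      swapProd f = π ∧ swapProd g = π ∧ (∀ p ∈ f, p.1 < p.2) ∧ (∀ p ∈ g, p.1 < p.2) ∧
      f.length = (P ++ c :: b :: d :: Q).length ∧ g.length = (P ++ c :: b :: d :: Q).length := by
  have hn := (List.nodup_cons.1 h.1).2
  have hcd : c ≠ d := by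
    rintro rfl
    have := hn.sublist (List.sublist_append_right _ _)
    simp at this
  have hstar := swapProd_star h hfix
  have hzc := hz c (by simp)
  have hzb := hz b (by simp)
  have hzd := hz d (by simp)
  have hzP : ∀ x ∈ P, z < x := fun x hx => hz x (by simp [hx])
  have hzQ : ∀ x ∈ Q, z < x := fun x hx => hz x (by simp [hx])
  obtain ⟨e₁, e₂⟩ := swapProd_exchange hzb.ne hzd.ne hbc.ne hbd.ne hcd
  have e : ((P ++ c :: b :: d :: Q).map fun x => (z, x)) =
      (P.map fun x => (z, x)) ++ ([(z, c), (z, b), (z, d)] ++ Q.map fun x => (z, x)) := by simp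
  rw [e, swapProd_append, swapProd_append] at hstar
  refine ⟨(P.map fun x => (z, x)) ++ ([(b, c), (z, c), (z, d)] ++ Q.map fun x => (z, x)),
    (P.map fun x => (z, x)) ++ ([(b, d), (z, c), (z, b)] ++ Q.map fun x => (z, x)),
    ?_, by simp, ?_, ?_, ?_, ?_, by simp, by simp⟩
  · intro h
    rw [List.append_cancel_left_eq, List.append_cancel_right_eq] at h
    simp [hcd] at h
  · rw [swapProd_append, swapProd_append, e₁, hstar]
  · rw [swapProd_append, swapProd_append, e₂, hstar]
  all_goals
    intro p hp
    simp only [List.mem_append, List.mem_map, List.mem_cons, List.not_mem_nil, or_false] at hp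
    rcases hp with ⟨x, hx, rfl⟩ | (rfl | rfl | rfl) | ⟨x, hx, rfl⟩
    · exact hzP x hx
    any_goals assumption
    exact hzQ x hx

end Star

section FullCycle

variable {n : ℕ} {σ : Equiv.Perm (Fin (n + 1))}

theorem IsFullCycle.sameCycle (hσ : IsFullCycle σ) (x y : Fin (n + 1)) : σ.SameCycle x y :=
  hσ.2 (Set.mem_univ x) (Set.mem_univ y)

theorem IsFullCycle.isOrbit (hσ : IsFullCycle σ) :
    IsOrbit σ 0 ((List.range n).map fun k => (σ ^ (k + 1)) 0) ∧
      ((0 : Fin (n + 1)) :: (List.range n).map fun k => (σ ^ (k + 1)) 0) =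
        (List.range (n + 1)).map fun k => (σ ^ k) 0 := by
  obtain ⟨p, h, e⟩ := exists_isOrbit_range σ 0
  have hlen := List.toFinset_card_of_nodup h.1
  have huniv : ((0 : Fin (n + 1)) :: (List.range p).map fun k => (σ ^ (k + 1)) 0).toFinset =
      Finset.univ :=
    Finset.eq_univ_of_forall fun x => List.mem_toFinset.2 (h.mem_iff.2 (hσ.sameCycle 0 x))
  rw [huniv, Finset.card_univ, Fintype.card_fin, List.length_cons, List.length_map,
    List.length_range] at hlen
  obtain rfl : n = p := by omega
  exact ⟨h, e⟩

theorem IsFullCycle.mem (hσ : IsFullCycle σ) (x : Fin (n + 1)) : ∃ k ≤ n, (σ ^ k) 0 = x := by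
  have := hσ.isOrbit.1.mem_iff.2 (hσ.sameCycle 0 x)
  rw [hσ.isOrbit.2, List.mem_map] at this
  obtain ⟨k, hk, rfl⟩ := this
  exact ⟨k, by rw [List.mem_range] at hk; omega, rfl⟩

theorem IsFullCycle.injOn (hσ : IsFullCycle σ) {i j : ℕ} (hi : i ≤ n) (hj : j ≤ n)
    (h : (σ ^ i) 0 = (σ ^ j) 0) : i = j := by
  have := hσ.isOrbit.1.1
  rw [hσ.isOrbit.2] at this
  exact List.inj_on_of_nodup_map this (by simp; omega) (by simp; omega) h

theorem IsUnimodal.orbitsUnimodal (hσ : IsFullCycle σ) (hu : IsUnimodal σ) :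
    OrbitsUnimodal σ := by
  intro x
  refine exists_cut_of_mem (P := []) (by simpa using hσ.isOrbit.1) ?_
    (by rw [List.append_nil]; exact hσ.isOrbit.1.mem_iff.2 (hσ.sameCycle 0 x))
  rw [List.nil_append, hσ.isOrbit.2]
  intro c a d hs hac had
  obtain ⟨l, hl, e⟩ := List.sublist_map_iff.1 hs
  obtain ⟨N, hN, -, hmono, hanti⟩ := hu
  have hlen := congrArg List.length e
  match l, hl, e with
  | [i, j, k], hl, e =>
    have hlt := (List.pairwise_lt_range (n := n + 1)).sublist hl
    have hk : k < n + 1 := List.mem_range.1 (hl.subset (by simp))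
    simp only [List.pairwise_cons, List.mem_cons, List.not_mem_nil, or_false] at hlt
    have hij := hlt.1 j (Or.inl rfl)
    have hjk := hlt.2.1 k rfl
    simp only [List.map_cons, List.map_nil, List.cons.injEq, and_true] at e
    obtain ⟨rfl, rfl, rfl⟩ := e
    rcases le_or_gt j N with hj | hj
    · exact (hmono ⟨Nat.zero_le _, by omega⟩ ⟨Nat.zero_le _, hj⟩ hij).asymm hac
    · exact (hanti ⟨hj.le, by omega⟩ ⟨by omega, by omega⟩ hjk).asymm had

theorem exists_valley (hσ : IsFullCycle σ) (hu : ¬ IsUnimodal σ) :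
    ∃ k, k + 2 ≤ n ∧ (σ ^ (k + 1)) 0 < (σ ^ k) 0 ∧ (σ ^ (k + 1)) 0 < (σ ^ (k + 2)) 0 := by
  by_contra! hv
  have hne : ∀ k, k + 1 ≤ n → (σ ^ k) 0 ≠ (σ ^ (k + 1)) 0 := fun k hk h => by
    have := hσ.injOn (by omega) hk h
    omega
  have desc : ∀ j, (σ ^ (j + 1)) 0 < (σ ^ j) 0 → ∀ m, j + m + 1 ≤ n →
      (σ ^ (j + m + 1)) 0 < (σ ^ (j + m)) 0 ∧ (σ ^ (j + m + 1)) 0 < (σ ^ j) 0 := by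
    intro j hj m
    induction m with
    | zero => exact fun _ => ⟨hj, hj⟩
    | succ m ih =>
      intro hm
      obtain ⟨h₁, h₂⟩ := ih (by omega)
      have h₃ := lt_of_le_of_ne (hv (j + m) (by omega) h₁) (hne (j + m + 1) (by omega)).symm
      exact ⟨h₃, h₃.trans h₂⟩
  obtain ⟨N, hN, hlast⟩ := hσ.mem (Fin.last n)
  refine hu ⟨N, hN, hlast, ?_, ?_⟩
  · refine strictMonoOn_of_lt_add_one Set.ordConnected_Icc fun k _ hk hk' => ?_
    refine lt_of_le_of_ne (not_lt.1 fun h => ?_) (hne k (by have := hk'.2; omega))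
    have := (desc k h (N - k - 1) (by have := hk'.2; omega)).2
    rw [show k + (N - k - 1) + 1 = N by have := hk'.2; omega, hlast] at this
    exact absurd this (not_lt.2 (Fin.le_last _))
  · refine strictAntiOn_of_add_one_lt Set.ordConnected_Icc fun k _ hk hk' => ?_
    have hkn := hk'.2
    have h := (desc N ?_ (k - N) (by have := hk.1; omega)).1
    · rwa [show N + (k - N) = k by have := hk.1; omega] at h
    · rw [hlast]
      refine lt_of_le_of_ne (Fin.le_last _) ?_
      rw [← hlast]
      exact (hne N (by have := hk.1; omega)).symm

/-- The list of pairs of symbols exchanged by the factors. -/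
def pairList (f : Fin n → Transposition n) : List (Fin (n + 1) × Fin (n + 1)) :=
  List.ofFn fun i => (lower (f i), upper (f i))

theorem lower_upper_of_eq_swap {τ : Transposition n} {a b : Fin (n + 1)} (hab : a < b)
    (h : τ.1 = Equiv.swap a b) : lower τ = a ∧ upper τ = b := by
  have hs : τ.1.support = {a, b} := by rw [h, Equiv.Perm.support_swap hab.ne]
  constructor
  · refine le_antisymm (Finset.min'_le _ _ (by simp [hs])) (Finset.le_min' _ _ _ fun y hy => ?_)
    rw [hs, Finset.mem_insert, Finset.mem_singleton] at hy
    rcases hy with rfl | rfl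
    exacts [le_rfl, hab.le]
  · refine le_antisymm (Finset.max'_le _ _ _ fun y hy => ?_) (Finset.le_max' _ _ (by simp [hs]))
    rw [hs, Finset.mem_insert, Finset.mem_singleton] at hy
    rcases hy with rfl | rfl
    exacts [hab.le, le_rfl]

theorem lower_lt_upper_and_eq_swap (τ : Transposition n) :
    lower τ < upper τ ∧ τ.1 = Equiv.swap (lower τ) (upper τ) := by
  obtain ⟨x, y, hxy, h⟩ := τ.2
  rcases hxy.lt_or_gt with hlt | hlt
  · obtain ⟨h₁, h₂⟩ := lower_upper_of_eq_swap hlt h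
    rw [h₁, h₂]
    exact ⟨hlt, h⟩
  · rw [Equiv.swap_comm] at h
    obtain ⟨h₁, h₂⟩ := lower_upper_of_eq_swap hlt h
    rw [h₁, h₂]
    exact ⟨hlt, h⟩

theorem swapProd_eq_prod (l : List (Fin (n + 1) × Fin (n + 1))) :
    swapProd l = (l.map fun p => Equiv.swap p.1 p.2).reverse.prod := by
  induction l with
  | nil => rfl
  | cons p l ih => simp [ih]

theorem mem_minimalFactorizations_iff {f : Fin n → Transposition n} :
    f ∈ minimalFactorizations σ ↔ swapProd (pairList f) = σ := by
  rw [swapProd_eq_prod, pairList, List.map_ofFn]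
  have : (fun i => (f i).1) =
      (fun p => Equiv.swap p.1 p.2) ∘ fun i => (lower (f i), upper (f i)) :=
    funext fun i => (lower_lt_upper_and_eq_swap (f i)).2
  rw [← this]
  rfl

theorem pairList_lt (f : Fin n → Transposition n) : ∀ p ∈ pairList f, p.1 < p.2 := by
  intro p hp
  obtain ⟨i, rfl⟩ := (List.mem_ofFn' _ _).1 hp
  exact (lower_lt_upper_and_eq_swap (f i)).1

theorem pairList_injective : Function.Injective (pairList (n := n)) := by
  intro f g h
  have := List.ofFn_injective h
  funext i
  have hi := congrFun this i
  simp only [Prod.mk.injEq] at hi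
  refine Subtype.ext ?_
  rw [(lower_lt_upper_and_eq_swap (f i)).2, (lower_lt_upper_and_eq_swap (g i)).2, hi.1, hi.2]

theorem exists_pairList {l : List (Fin (n + 1) × Fin (n + 1))} (hl : ∀ p ∈ l, p.1 < p.2)
    (hlen : l.length = n) : ∃ f : Fin n → Transposition n, pairList f = l := by
  have hi : ∀ i : Fin n, (i : ℕ) < l.length := fun i => hlen.symm ▸ i.2
  have hlt : ∀ i : Fin n, (l[(i : ℕ)]'(hi i)).1 < (l[(i : ℕ)]'(hi i)).2 :=
    fun i => hl _ (List.getElem_mem _)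
  refine ⟨fun i => ⟨Equiv.swap (l[(i : ℕ)]'(hi i)).1 (l[(i : ℕ)]'(hi i)).2, _, _, (hlt i).ne, rfl⟩,
    List.ext_getElem (by simp [pairList, hlen]) fun i h₁ h₂ => ?_⟩
  have := fun j => lower_upper_of_eq_swap (τ := ⟨_, _, _, (hlt j).ne, rfl⟩) (hlt j) rfl
  simp [pairList, this]

theorem map_fst_pairList (f : Fin n → Transposition n) :
    (pairList f).map Prod.fst = List.ofFn fun i => lower (f i) := by
  rw [pairList, List.map_ofFn]; rfl

theorem lowerSeq_eq_iff {f g : Fin n → Transposition n} :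
    lowerSeq f = lowerSeq g ↔ (pairList f).map Prod.fst = (pairList g).map Prod.fst := by
  rw [map_fst_pairList, map_fst_pairList, List.ofFn_injective.eq_iff]
  simp only [funext_iff, lowerSeq, Fin.ext_iff]

theorem isMerging_pairList (hσ : IsFullCycle σ) {f : Fin n → Transposition n}
    (hf : f ∈ minimalFactorizations σ) : IsMerging (pairList f) := by
  refine isMerging_of_forall_sameCycle (pairList_lt f) (by simp [pairList]) fun x y => ?_
  rw [mem_minimalFactorizations_iff.1 hf]
  exact hσ.sameCycle x y

theorem mem_parkingFunctions_iff {a : Fin n → ℕ} :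
    a ∈ parkingFunctions n ↔ ∀ i : Fin n, (i : ℕ) < (Finset.univ.filter fun j => a j ≤ i).card := by
  refine forall_congr' fun i => ?_
  rw [← Tuple.lt_card_le_iff_apply_le_of_monotone (Tuple.monotone_sort a)]
  have : (Finset.univ.filter fun j => (a ∘ Tuple.sort a) j ≤ (i : ℕ)).card =
      (Finset.univ.filter fun j => a j ≤ (i : ℕ)).card := by
    refine Finset.card_bij (fun j _ => Tuple.sort a j) (by simp) (by simp) fun j hj => ?_
    exact ⟨(Tuple.sort a).symm j, by simpa using hj, by simp⟩
  rw [this]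

theorem sumFrom_weight (g : Fin n → Fin (n + 1)) {L : List (Fin (n + 1))} (hn : L.Nodup)
    (hL : ∀ x, x ∈ L) (k : Fin (n + 1)) :
    sumFrom (weight (List.ofFn g)) k L =
      1 - k + ((Finset.univ.filter fun i => g i < k).card : ℤ) := by
  have hcount : ∀ y, ((List.ofFn g).count y : ℤ) = ∑ i, if g i = y then 1 else 0 := by
    intro y
    have hl : ∀ l : List (Fin (n + 1)),
        (l.count y : ℤ) = (l.map fun x => if x = y then 1 else 0).sum := by
      intro l
      induction l with
      | nil => rfl
      | cons x l ih =>
        rw [List.count_cons, List.map_cons, List.sum_cons, ← ih]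
        by_cases h : x = y <;> simp [h, add_comm]
    rw [hl, List.map_ofFn, List.sum_ofFn]
    rfl
  have hun : L.toFinset = Finset.univ := Finset.eq_univ_of_forall fun x => by simp [hL]
  unfold sumFrom
  rw [← List.sum_toFinset _ hn, hun, ← Finset.sum_filter]
  simp only [weight, hcount]
  rw [Finset.sum_sub_distrib, Finset.sum_comm]
  have h₁ : ∀ i, (∑ y ∈ Finset.univ.filter (k ≤ ·), if g i = y then (1 : ℤ) else 0) =
      1 - if g i < k then 1 else 0 := by
    intro i
    rw [Finset.sum_ite_eq]
    by_cases h : k ≤ g i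
    · simp [h, not_lt.2 h]
    · simp [h, not_le.1 h]
  simp only [h₁]
  have h₂ : (Finset.univ.filter (k ≤ ·)).card = n + 1 - k := by
    rw [← Fin.card_Ici]
    congr 1
    ext; simp
  rw [Finset.sum_sub_distrib, Finset.sum_boole]
  simp only [Finset.sum_const, Finset.card_univ, Fintype.card_fin, h₂]
  have := k.2
  simp
  omega

theorem balanced_iff_mem_parkingFunctions (g : Fin n → Fin (n + 1)) {L : List (Fin (n + 1))}
    (hn : L.Nodup) (hL : ∀ x, x ∈ L) :
    Balanced (weight (List.ofFn g)) L ↔ (fun i => (g i : ℕ)) ∈ parkingFunctions n := by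
  have htot : (L.map (weight (List.ofFn g))).sum = 1 := by
    rw [← sumFrom_eq_sum (k := 0) fun x _ => Fin.zero_le x, sumFrom_weight g hn hL]
    simp
  rw [mem_parkingFunctions_iff, Balanced, and_iff_right htot]
  constructor
  · intro h i
    have := h i.succ (hL _)
    rw [sumFrom_weight g hn hL] at this
    simp only [Fin.lt_def, Fin.val_succ, Nat.lt_succ_iff] at this
    push_cast at this
    omega
  · intro h k hk
    rw [sumFrom_weight g hn hL]
    refine Fin.cases ?_ (fun i => ?_) k
    · simp
    · have := h i
      simp only [Fin.lt_def, Fin.val_succ, Nat.lt_succ_iff]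
      push_cast
      omega

end FullCycle

variable {n : ℕ} {σ : Equiv.Perm (Fin (n + 1))}

theorem mapsTo_lowerSeq (hσ : IsFullCycle σ) :
    Set.MapsTo lowerSeq (minimalFactorizations σ) (parkingFunctions n) := by
  intro f hf
  have hb := (isMerging_pairList hσ hf).orbitsBalanced
  rw [mem_minimalFactorizations_iff.1 hf, map_fst_pairList] at hb
  exact (balanced_iff_mem_parkingFunctions _ hσ.isOrbit.1.1
    fun x => hσ.isOrbit.1.mem_iff.2 (hσ.sameCycle 0 x)).1 (hb _ _ hσ.isOrbit.1)

theorem bijOn_lowerSeq (hσ : IsFullCycle σ) (hu : IsUnimodal σ) :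
    Set.BijOn lowerSeq (minimalFactorizations σ) (parkingFunctions n) := by
  have hO := hu.orbitsUnimodal hσ
  refine ⟨mapsTo_lowerSeq hσ, fun f hf g hg h => ?_, fun a ha => ?_⟩
  · rw [lowerSeq_eq_iff] at h
    refine pairList_injective
      (isMerging_unique (isMerging_pairList hσ hf) (isMerging_pairList hσ hg) ?_ ?_ h)
    · rwa [mem_minimalFactorizations_iff.1 hf]
    · rw [mem_minimalFactorizations_iff.1 hf, mem_minimalFactorizations_iff.1 hg]
  · have hlt : ∀ i, a i < n + 1 := by
      intro i
      by_contra h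
      have hcard := mem_parkingFunctions_iff.1 ha ⟨n - 1, by have := i.2; omega⟩
      have : (Finset.univ.filter fun j => a j ≤ n - 1).card < Fintype.card (Fin n) :=
        Finset.card_lt_univ_of_notMem (x := i) (by simp; omega)
      rw [Fintype.card_fin] at this
      simp only at hcard
      omega
    obtain ⟨f, hf, hp, hfst⟩ := exists_isMerging (List.ofFn fun i => ⟨a i, hlt i⟩) hO
      fun c L hL => (balanced_iff_mem_parkingFunctions (fun i => ⟨a i, hlt i⟩) hL.1
        fun x => hL.mem_iff.2 (hσ.sameCycle c x)).2 ha
    obtain ⟨F, rfl⟩ := exists_pairList hf.lt (by simpa using congrArg List.length hfst)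
    refine ⟨F, mem_minimalFactorizations_iff.2 hp, ?_⟩
    rw [map_fst_pairList] at hfst
    have := List.ofFn_injective hfst
    funext i
    exact congrArg Fin.val (congrFun this i)

theorem isUnimodal_of_injOn_lowerSeq (hσ : IsFullCycle σ)
    (h : Set.InjOn lowerSeq (minimalFactorizations σ)) : IsUnimodal σ := by
  by_contra hu
  obtain ⟨k, hk, h₁, h₂⟩ := exists_valley hσ hu
  obtain ⟨m, rfl⟩ := Nat.exists_eq_add_of_le hk
  obtain ⟨j, rfl⟩ : ∃ j, k = j + 1 := by
    refine Nat.exists_eq_succ_of_ne_zero ?_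
    rintro rfl
    simp at h₁
  have ho := hσ.isOrbit.1
  have hmem : ∀ x, x ∈ (0 : Fin (j + 1 + 2 + m + 1)) :: _ :=
    fun x => ho.mem_iff.2 (hσ.sameCycle 0 x)
  have e : (List.range (j + 1 + 2 + m)).map (fun k => (σ ^ (k + 1)) 0) =
      ((List.range j).map fun k => (σ ^ (k + 1)) 0) ++ (σ ^ (j + 1)) 0 :: (σ ^ (j + 1 + 1)) 0 ::
        (σ ^ (j + 1 + 2)) 0 :: (List.range m).map fun k => (σ ^ (j + 3 + k + 1)) 0 := by
    have hr : List.range (j + 1 + 2 + m) =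
        List.range j ++ j :: (j + 1) :: (j + 2) :: (List.range m).map (j + 3 + ·) := by
      rw [show j + 1 + 2 + m = j + (m + 1 + 1 + 1) by ring, List.range_add]
      simp [List.range_succ_eq_map, Function.comp_def]
      intros
      ring
    rw [hr]
    simp [Function.comp_def]
  rw [e] at ho hmem
  obtain ⟨f, g, hne, hfst, hf, hg, hf', hg', hfl, hgl⟩ := exists_collision ho
    (fun x hx => absurd (hmem x) hx) (fun x hx => Fin.pos_iff_ne_zero.2 fun h0 => by
      rw [h0] at hx; exact (List.nodup_cons.1 ho.1).1 hx) h₁ h₂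
  rw [← e, List.length_map, List.length_range] at hfl hgl
  obtain ⟨F, rfl⟩ := exists_pairList hf' hfl
  obtain ⟨G, rfl⟩ := exists_pairList hg' hgl
  exact hne (congrArg _ (h (mem_minimalFactorizations_iff.2 hf)
    (mem_minimalFactorizations_iff.2 hg) (lowerSeq_eq_iff.2 hfst)))

section Reversal

/-- The permutation obtained by replacing each symbol `i` by `n - i`. -/
def revConj (σ : Equiv.Perm (Fin (n + 1))) : Equiv.Perm (Fin (n + 1)) :=
  MulAut.conj Fin.revPerm σ

theorem revConj_apply (σ : Equiv.Perm (Fin (n + 1))) (x : Fin (n + 1)) :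
    revConj σ x = (σ x.rev).rev := rfl

theorem revConj_revConj (σ : Equiv.Perm (Fin (n + 1))) : revConj (revConj σ) = σ := by
  ext x; simp [revConj_apply]

theorem revConj_pow_apply (σ : Equiv.Perm (Fin (n + 1))) (k : ℕ) (x : Fin (n + 1)) :
    (revConj σ ^ k) x = ((σ ^ k) x.rev).rev := by
  rw [revConj, ← map_pow]; rfl

theorem revConj_swap (a b : Fin (n + 1)) :
    revConj (Equiv.swap a b) = Equiv.swap a.rev b.rev := by
  rw [← Fin.revPerm_apply a, ← Fin.revPerm_apply b, Equiv.swap_apply_apply]; rfl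

theorem IsFullCycle.revConj (hσ : IsFullCycle σ) : IsFullCycle (revConj σ) := by
  refine ⟨Set.bijOn_univ.2 (FullCycleFact.revConj σ).bijective, fun x _ y _ => ?_⟩
  obtain ⟨k, hk⟩ := (hσ.sameCycle x.rev y.rev).exists_nat_pow_eq
  exact ⟨k, by rw [zpow_natCast, revConj_pow_apply, hk, Fin.rev_rev]⟩

theorem IsFullCycle.pow_succ_apply (hσ : IsFullCycle σ) (x : Fin (n + 1)) :
    (σ ^ (n + 1)) x = x := by
  have h : σ.IsCycleOn (Finset.univ : Finset (Fin (n + 1))) := by rw [Finset.coe_univ]; exact hσ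
  simpa using h.pow_card_apply (Finset.mem_univ x)

theorem IsUnimodal.revConj (hσ : IsFullCycle σ) (hu : IsUnimodal σ) :
    IsUnimodal (revConj σ) := by
  obtain ⟨N, hN, hlast, hmono, hanti⟩ := hu
  have hs : ∀ k, (FullCycleFact.revConj σ ^ k) 0 = ((σ ^ (k + N)) 0).rev := by
    intro k
    rw [revConj_pow_apply, Fin.rev_zero, ← hlast, pow_add, Equiv.Perm.mul_apply]
  have hw : ∀ k, (σ ^ (k + (n + 1))) 0 = (σ ^ k) 0 := fun k => by
    rw [pow_add, Equiv.Perm.mul_apply, hσ.pow_succ_apply]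
  rcases Nat.eq_zero_or_pos n with rfl | hn
  · refine ⟨0, le_rfl, Subsingleton.elim (α := Fin 1) _ _, ?_, ?_⟩ <;> intro a ha b hb hab <;>
      simp only [Set.mem_Icc] at ha hb <;> omega
  have hN0 : 0 < N := by
    rcases Nat.eq_zero_or_pos N with rfl | h
    · have := congrArg Fin.val hlast
      simp at this; omega
    · exact h
  refine ⟨n + 1 - N, by omega, ?_, ?_, ?_⟩
  · rw [hs, show n + 1 - N + N = 0 + (n + 1) by omega, hw]; simp
  · intro i hi j hj hij
    simp only [Set.mem_Icc] at hi hj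
    simp only [hs, Fin.rev_lt_rev]
    rcases eq_or_ne j (n + 1 - N) with rfl | hj'
    · rw [show n + 1 - N + N = 0 + (n + 1) by omega, hw]
      refine Fin.pos_iff_ne_zero.2 fun h => ?_
      have := hσ.injOn (i := i + N) (j := 0) (by omega) (by omega) (by simpa using h)
      omega
    · exact hanti ⟨by omega, by omega⟩ ⟨by omega, by omega⟩ (by omega)
  · intro i hi j hj hij
    simp only [Set.mem_Icc] at hi hj
    simp only [hs, Fin.rev_lt_rev]
    rw [show i + N = (i + N - (n + 1)) + (n + 1) by omega, hw,
      show j + N = (j + N - (n + 1)) + (n + 1) by omega, hw]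
    exact hmono ⟨by omega, by omega⟩ ⟨by omega, by omega⟩ (by omega)

/-- The transposition obtained by replacing each symbol `i` by `n - i`. -/
def revTransposition (τ : Transposition n) : Transposition n :=
  ⟨revConj τ.1, by
    obtain ⟨x, y, hxy, h⟩ := τ.2
    exact ⟨x.rev, y.rev, fun e => hxy (Fin.rev_injective e), by rw [h, revConj_swap]⟩⟩

theorem lower_revTransposition (τ : Transposition n) :
    lower (revTransposition τ) = (upper τ).rev := by
  obtain ⟨h₁, h₂⟩ := lower_lt_upper_and_eq_swap τ
  refine (lower_upper_of_eq_swap (b := (lower τ).rev) (Fin.rev_lt_rev.2 h₁) ?_).1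
  rw [Equiv.swap_comm, ← revConj_swap, ← h₂]
  rfl

theorem revTransposition_revTransposition (τ : Transposition n) :
    revTransposition (revTransposition τ) = τ :=
  Subtype.ext (revConj_revConj τ.1)

theorem revTransposition_mem {f : Fin n → Transposition n} (hf : f ∈ minimalFactorizations σ) :
    revTransposition ∘ f ∈ minimalFactorizations (revConj σ) := by
  change _ = _ at hf ⊢
  rw [← hf, revConj, map_list_prod, List.map_reverse, List.map_ofFn]
  rfl

theorem bijOn_revTransposition (σ : Equiv.Perm (Fin (n + 1))) :
    Set.BijOn (revTransposition ∘ ·) (minimalFactorizations σ)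
      (minimalFactorizations (revConj σ)) := by
  have hinv : ∀ f : Fin n → Transposition n, revTransposition ∘ revTransposition ∘ f = f :=
    fun f => funext fun i => revTransposition_revTransposition (f i)
  refine Set.BijOn.mk (fun f hf => revTransposition_mem hf) (fun f _ g _ h => ?_) fun f hf => ?_
  · have h : revTransposition ∘ f = revTransposition ∘ g := h
    rw [← hinv f, h, hinv]
  · refine ⟨revTransposition ∘ f, ?_, hinv f⟩
    rw [← revConj_revConj σ]
    exact revTransposition_mem hf

theorem lowerSeq_revTransposition_add_upperSeq (f : Fin n → Transposition n) (i : Fin n) :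
    lowerSeq (revTransposition ∘ f) i + upperSeq f i = n := by
  simp only [lowerSeq, upperSeq, Function.comp_apply, lower_revTransposition, Fin.val_rev]
  have := (upper (f i)).2
  omega

theorem mapsTo_upperSeq (hσ : IsFullCycle σ) :
    Set.MapsTo upperSeq (minimalFactorizations σ) (majorSequences n) := fun f hf =>
  ⟨_, mapsTo_lowerSeq hσ.revConj (revTransposition_mem hf),
    lowerSeq_revTransposition_add_upperSeq f⟩

theorem upperSeq_eq_iff {f g : Fin n → Transposition n} :
    upperSeq f = upperSeq g ↔
      lowerSeq (revTransposition ∘ f) = lowerSeq (revTransposition ∘ g) := by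
  simp only [funext_iff]
  refine forall_congr' fun i => ?_
  have h₁ := lowerSeq_revTransposition_add_upperSeq f i
  have h₂ := lowerSeq_revTransposition_add_upperSeq g i
  omega

theorem bijOn_upperSeq (hσ : IsFullCycle σ) (hu : IsUnimodal σ) :
    Set.BijOn upperSeq (minimalFactorizations σ) (majorSequences n) := by
  have hl := bijOn_lowerSeq hσ.revConj (hu.revConj hσ)
  have hr := bijOn_revTransposition σ
  refine ⟨mapsTo_upperSeq hσ, fun f hf g hg h => ?_, ?_⟩
  · exact hr.injOn hf hg (hl.injOn (hr.mapsTo hf) (hr.mapsTo hg) (upperSeq_eq_iff.1 h))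
  · rintro b ⟨a, ha, hab⟩
    obtain ⟨g, hg, rfl⟩ := hl.surjOn ha
    obtain ⟨f, hf, rfl⟩ := hr.surjOn hg
    refine ⟨f, hf, funext fun i => ?_⟩
    have h₁ := lowerSeq_revTransposition_add_upperSeq f i
    have h₂ := hab i
    simp only at h₂
    omega

theorem isUnimodal_of_injOn_upperSeq (hσ : IsFullCycle σ)
    (h : Set.InjOn upperSeq (minimalFactorizations σ)) : IsUnimodal σ := by
  rw [← revConj_revConj σ]
  refine IsUnimodal.revConj hσ.revConj (isUnimodal_of_injOn_lowerSeq hσ.revConj ?_)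
  intro f' hf' g' hg' hfg
  obtain ⟨f, hf, rfl⟩ := (bijOn_revTransposition σ).surjOn hf'
  obtain ⟨g, hg, rfl⟩ := (bijOn_revTransposition σ).surjOn hg'
  rw [h hf hg (upperSeq_eq_iff.2 hfg)]

end Reversal

end FullCycleFact

theorem theorem2p2 (n : ℕ) (σ : Equiv.Perm (Fin (n + 1)))
    (hσ : FullCycleFact.IsFullCycle σ) :
    Set.MapsTo FullCycleFact.lowerSeq (FullCycleFact.minimalFactorizations σ)
        (FullCycleFact.parkingFunctions n) ∧
      Set.MapsTo FullCycleFact.upperSeq (FullCycleFact.minimalFactorizations σ)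
        (FullCycleFact.majorSequences n) ∧
      List.TFAE [
        FullCycleFact.IsUnimodal σ,
        Set.BijOn FullCycleFact.lowerSeq (FullCycleFact.minimalFactorizations σ)
          (FullCycleFact.parkingFunctions n),
        Set.BijOn FullCycleFact.upperSeq (FullCycleFact.minimalFactorizations σ)
          (FullCycleFact.majorSequences n)] := by
  refine ⟨FullCycleFact.mapsTo_lowerSeq hσ, FullCycleFact.mapsTo_upperSeq hσ, ?_⟩
  tfae_have 1 → 2 := FullCycleFact.bijOn_lowerSeq hσ
  tfae_have 2 → 1 := fun h => FullCycleFact.isUnimodal_of_injOn_lowerSeq hσ h.injOn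
  tfae_have 1 → 3 := FullCycleFact.bijOn_upperSeq hσ
  tfae_have 3 → 1 := fun h => FullCycleFact.isUnimodal_of_injOn_upperSeq hσ h.injOn
  tfae_finish
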